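/- Write $\mathrm{Prob}(n)$ for the set of vectors in $\mathbb{R}^n$ with non-negative entries summing to $1$. A real $n'\times n$ matrix is called stochastic if its entries are non-negative and each of its columns sums to $1$. For $p,q\in\mathrm{Prob}(n)$, the testing region of $(p,q)$ is $$\mathfrak{T}(p,q)=\{(t\cdot p,\;t\cdot q) : t\in[0,1]^n\}\subseteq\mathbb{R}^2 .$$ **Theorem (Blackwell).** Let $p,q\in\mathrm{Prob}(n)$ and $p',q'\in\mathrm{Prob}(n')$. The following are equivalent: 1. $(p,q)$ relatively majorizes $(p',q')$, that is, there is a stochastic $n'\times n$ matrix $E$ with $Ep=p'$ and $Eq=q'$; 2. $\|p-tq\|_1\ge\|p'-tq'\|_1$ for every $t\in\mathbb{R}$, where $\|v\|_1=\sum_i|v_i|$; 3. $\mathfrak{T}(p,q)\supseteq\mathfrak{T}(p',q')$. -/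

import Mathlib

open scoped Matrix

/-- The set `Prob(n)` of `n`-dimensional probability vectors: nonnegative entries summing to `1`. -/
abbrev ProbVec (n : ℕ) : Set (Fin n → ℝ) := stdSimplex ℝ (Fin n)

/-- The set `Stoch(m, n)` of (column) stochastic `m × n` real matrices: nonnegative entries, and
every column sums to `1`. -/
def StochMatrix (m n : ℕ) : Set (Matrix (Fin m) (Fin n) ℝ) :=
  {E | (∀ i j, 0 ≤ E i j) ∧ ∀ j, ∑ i, E i j = 1}

/-- The pair `(p, q)` relatively majorizes the pair `(p', q')`: some stochastic matrix sends
`p` to `p'` and `q` to `q'`. -/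
def RelMajorizes {n n' : ℕ} (p q : Fin n → ℝ) (p' q' : Fin n' → ℝ) : Prop :=
  ∃ E ∈ StochMatrix n' n, E *ᵥ p = p' ∧ E *ᵥ q = q'

/-- The testing region `{(t ⬝ p, t ⬝ q) | t ∈ [0,1]ⁿ}` of the pair `(p, q)`. -/
def testingRegion {n : ℕ} (p q : Fin n → ℝ) : Set (ℝ × ℝ) :=
  {x | ∃ t : Fin n → ℝ, (∀ i, t i ∈ Set.Icc (0 : ℝ) 1) ∧ x = (t ⬝ᵥ p, t ⬝ᵥ q)}

/-- The `1`-norm of a real vector. -/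
noncomputable def oneNorm {n : ℕ} (v : Fin n → ℝ) : ℝ := ‖WithLp.toLp 1 v‖

theorem oneNorm_eq_sum_abs {n : ℕ} (v : Fin n → ℝ) : oneNorm v = ∑ i, |v i| := by
  simp [oneNorm, PiLp.norm_eq_of_L1]

/-!
The passage from stochastic matrices to testing regions is duality: if `E` maps `(p, q)` to
`(p', q')`, then the test `t'` on `(p', q')` has the same outcome as the test `t' ᵥ* E` on `(p, q)`.
The passage from testing regions to `1`-norms rests on `∑ |v i| = max_t (2 t ⬝ v) - ∑ v i`, the
maximum being over tests `t`.

The remaining implication is a separation argument. The pairs `(E p, E q)`, with `E` stochastic, form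
a compact convex set. If `(p', q')` were outside of it, then some linear functional with
coefficients `a, b` would be strictly larger at `(p', q')` than on the set; the maximum of
the functional on the set is `∑ j, max_i (a i * p j + b i * q j)`. So it has to be shown
(`sum_linear_le_sum_of_abs_le`) that
`∑ i, (a i * p' i + b i * q' i) ≤ ∑ j, max_i (a i * p j + b i * q j)`.
In the projective coordinate `u = p / (p + q)` with weights `p + q`, the right hand side
integrates the convex function `g u = max_i (a i * u + b i * (1 - u))`, and the left hand side is at
most the integral of `g` over the primed pair. The `1`-norm condition compares
these integrals for the functions `|u - x|`, and for affine functions they agree. On a finite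
set every convex function is a nonnegative combination of functions `|u - x|` plus an affine
function, which gives the comparison for `g` (`sum_mul_convex_nonneg`).
-/

/-! ### Convex order for finitely supported signed measures -/

/-- A convex function is interpolated at finitely many points by adding hinges
`(x - m) + |x - m|` with nonnegative coefficients, from left to right. The function `h` is affine to
the right of the last node `m` and lies below `g` there, so that the next coefficient is again
nonnegative. The sign condition on `∑ i, c i * h (u i)` is preserved by each hinge. -/
theorem exists_hinge_interpolation {ι : Type*} [Fintype ι] {c u : ι → ℝ} {g : ℝ → ℝ}
    (hg : ConvexOn ℝ Set.univ g) (h0 : ∑ i, c i = 0) (h1 : ∑ i, c i * u i = 0)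
    (habs : ∀ m : ℝ, 0 ≤ ∑ i, c i * |u i - m|) (m₀ : ℝ) (S : Finset ℝ) (hS : ∀ s ∈ S, m₀ < s) :
    ∃ (h : ℝ → ℝ) (a m : ℝ), 0 ≤ ∑ i, c i * h (u i) ∧ m ∈ insert m₀ S ∧
      (∀ s ∈ S, s ≤ m ∧ h s = g s) ∧ ∀ x, m ≤ x → h x = g m + a * (x - m) ∧ h x ≤ g x := by
  induction S using Finset.induction_on_max with
  | empty =>
    -- The line through the graph points over `m₀ - 1` and `m₀` lies below `g` on `[m₀, ∞)`.
    refine ⟨fun x => g m₀ + (g m₀ - g (m₀ - 1)) * (x - m₀), g m₀ - g (m₀ - 1), m₀, ?_, by simp,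
      by simp, fun x hx => ⟨rfl, ?_⟩⟩
    · have : ∑ i, c i * (g m₀ + (g m₀ - g (m₀ - 1)) * (u i - m₀)) =
          (g m₀ - (g m₀ - g (m₀ - 1)) * m₀) * ∑ i, c i +
            (g m₀ - g (m₀ - 1)) * ∑ i, c i * u i := by
        rw [Finset.mul_sum, Finset.mul_sum, ← Finset.sum_add_distrib]
        exact Finset.sum_congr rfl fun i _ => by ring
      simp [this, h0, h1]
    · rcases hx.eq_or_lt with rfl | hx
      · simp
      · have h := hg.slope_mono_adjacent (Set.mem_univ (m₀ - 1)) (Set.mem_univ x)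
          (sub_one_lt m₀) hx
        rw [sub_sub_cancel, div_one, le_div_iff₀ (sub_pos.2 hx)] at h
        linarith
  | insert s S hmax ih =>
    obtain ⟨h, a, m, hsum, hmS, hint, haff⟩ :=
      ih fun x hx => hS x (Finset.mem_insert_of_mem hx)
    have hms : m < s := by
      rcases Finset.mem_insert.1 hmS with rfl | hm
      · exact hS s (Finset.mem_insert_self _ _)
      · exact hmax m hm
    have hpos := sub_pos.2 hms
    obtain ⟨a', ha'⟩ : ∃ a', a' = (g s - g m) / (s - m) := ⟨_, rfl⟩
    have hs : g m + a' * (s - m) = g s := by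
      rw [ha', div_mul_cancel₀ _ hpos.ne']; ring
    have haa : a ≤ a' := by
      obtain ⟨e1, e2⟩ := haff s hms.le
      rw [ha', le_div_iff₀ hpos]
      linarith
    have hright : ∀ x, m ≤ x →
        h x + (a' - a) / 2 * ((x - m) + |x - m|) = g m + a' * (x - m) := by
      intro x hx
      rw [(haff x hx).1, abs_of_nonneg (sub_nonneg.2 hx)]; ring
    refine ⟨fun x => h x + (a' - a) / 2 * ((x - m) + |x - m|), a', s, ?_, by simp, ?_, ?_⟩
    · have : ∑ i, c i * (h (u i) + (a' - a) / 2 * ((u i - m) + |u i - m|)) =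
          ∑ i, c i * h (u i) + (a' - a) / 2 *
            ((∑ i, c i * u i) - m * ∑ i, c i + ∑ i, c i * |u i - m|) := by
        simp only [Finset.mul_sum, ← Finset.sum_add_distrib, ← Finset.sum_sub_distrib]
        exact Finset.sum_congr rfl fun i _ => by ring
      rw [this, h0, h1]
      have := mul_nonneg (sub_nonneg.2 haa) (habs m)
      linarith
    · intro x hx
      rcases Finset.mem_insert.1 hx with rfl | hx
      · exact ⟨le_rfl, (hright _ hms.le).trans hs⟩
      · refine ⟨(hmax x hx).le, ?_⟩
        simp only [abs_of_nonpos (sub_nonpos.2 (hint x hx).1), (hint x hx).2]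
        ring
    · intro x hx
      have hx' : h x + (a' - a) / 2 * ((x - m) + |x - m|) = g s + a' * (x - s) := by
        rw [hright x (hms.le.trans hx), ← hs]; ring
      refine ⟨hx', hx'.le.trans ?_⟩
      rcases hx.eq_or_lt with rfl | hx
      · simp
      · have h := hg.slope_mono_adjacent (Set.mem_univ m) (Set.mem_univ x) hms hx
        rw [← ha', le_div_iff₀ (sub_pos.2 hx)] at h
        linarith

/-- A finitely supported signed measure that annihilates affine functions and is nonnegative on the
functions `|· - m|` is nonnegative on all convex functions. -/
theorem sum_mul_convex_nonneg {ι : Type*} [Fintype ι] {c u : ι → ℝ} {g : ℝ → ℝ}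
    (hg : ConvexOn ℝ Set.univ g) (h0 : ∑ i, c i = 0) (h1 : ∑ i, c i * u i = 0)
    (habs : ∀ m : ℝ, 0 ≤ ∑ i, c i * |u i - m|) : 0 ≤ ∑ i, c i * g (u i) := by
  obtain ⟨b, hb⟩ := (Set.finite_range u).bddBelow
  obtain ⟨h, _, _, hsum, -, hint, -⟩ := exists_hinge_interpolation hg h0 h1 habs (b - 1)
    (Finset.univ.image u) (by
      intro s hs
      obtain ⟨i, -, rfl⟩ := Finset.mem_image.1 hs
      linarith [hb (Set.mem_range_self i)])
  refine hsum.trans_eq (Finset.sum_congr rfl fun i _ => ?_)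
  rw [(hint (u i) (Finset.mem_image_of_mem u (Finset.mem_univ i))).2]

/-! ### Comparison of `1`-norms and of maxima of linear functions -/

/-- Monotonicity of the `1`-norms along the lines `p - t • q` extends to all linear combinations. -/
theorem sum_abs_le_of_oneNorm_le {n n' : ℕ} {p q : Fin n → ℝ} {p' q' : Fin n' → ℝ}
    (hq : q ∈ ProbVec n) (hq' : q' ∈ ProbVec n')
    (h : ∀ t : ℝ, oneNorm (p' - t • q') ≤ oneNorm (p - t • q)) (α β : ℝ) :
    ∑ i, |α * p' i + β * q' i| ≤ ∑ j, |α * p j + β * q j| := by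
  by_cases hα : α = 0
  · simp only [hα, zero_mul, zero_add, abs_mul, ← Finset.mul_sum, abs_of_nonneg (hq.1 _),
      abs_of_nonneg (hq'.1 _), hq.2, hq'.2, le_refl]
  · have key : ∀ x y : ℝ, |α * x + β * y| = |α| * |x - -β / α * y| := fun x y => by
      rw [← abs_mul]; congr 1; field_simp; ring
    have := h (-β / α)
    simp only [oneNorm_eq_sum_abs, Pi.sub_apply, Pi.smul_apply, smul_eq_mul] at this
    simp only [key, ← Finset.mul_sum]
    exact mul_le_mul_of_nonneg_left this (abs_nonneg α)

/-- If `(p, q)` dominates `(p', q')` in all functions `|α x + β y|`, then it does so in the maximum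
of any finite family of linear functions `a i * x + b i * y`, here bounded below on the primed side
by evaluating the `i`-th function at the `i`-th point. -/
theorem sum_linear_le_sum_of_abs_le {n n' : ℕ} {p q : Fin n → ℝ} {p' q' : Fin n' → ℝ}
    (hp : p ∈ ProbVec n) (hq : q ∈ ProbVec n) (hp' : p' ∈ ProbVec n') (hq' : q' ∈ ProbVec n')
    (h : ∀ α β : ℝ, ∑ i, |α * p' i + β * q' i| ≤ ∑ j, |α * p j + β * q j|)
    (a b : Fin n' → ℝ) (k : Fin n → Fin n')
    (hk : ∀ j i, a i * p j + b i * q j ≤ a (k j) * p j + b (k j) * q j) :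
    ∑ i, (a i * p' i + b i * q' i) ≤ ∑ j, (a (k j) * p j + b (k j) * q j) := by
  have hne : (Finset.univ : Finset (Fin n')).Nonempty := by
    by_contra hne
    rw [Finset.not_nonempty_iff_eq_empty] at hne
    simpa [hne] using hp'.2
  let g : ℝ → ℝ := fun x => Finset.univ.sup' hne fun i => a i * x + b i * (1 - x)
  have hle : ∀ x i, a i * x + b i * (1 - x) ≤ g x := fun x i =>
    Finset.le_sup' (fun i => a i * x + b i * (1 - x)) (Finset.mem_univ i)
  have hg : ConvexOn ℝ Set.univ g := by
    refine ⟨convex_univ, fun x _ y _ r s hr hs hrs => Finset.sup'_le _ _ fun i _ => ?_⟩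
    have e : a i * (r • x + s • y) + b i * (1 - (r • x + s • y)) =
        r * (a i * x + b i * (1 - x)) + s * (a i * y + b i * (1 - y)) := by
      simp only [smul_eq_mul]
      linear_combination (-b i) * hrs
    rw [e]
    exact add_le_add (mul_le_mul_of_nonneg_left (hle x i) hr)
      (mul_le_mul_of_nonneg_left (hle y i) hs)
  -- Where `x + y = 0` the coordinate `x / (x + y)` is zero, and `x` vanishes as well.
  have hu : ∀ x y : ℝ, 0 ≤ x → 0 ≤ y → (x + y) * (x / (x + y)) = x := fun x y hx hy =>
    mul_div_cancel_of_imp' fun e => by linarith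
  have habs : ∀ x y m : ℝ, 0 ≤ x → 0 ≤ y →
      (x + y) * |x / (x + y) - m| = |(1 - m) * x + -m * y| := fun x y m hx hy => by
    rw [← abs_of_nonneg (add_nonneg hx hy), ← abs_mul, abs_of_nonneg (add_nonneg hx hy), mul_sub,
      hu x y hx hy]
    congr 1; ring
  have hlin : ∀ (x y : ℝ) i, 0 ≤ x → 0 ≤ y →
      (x + y) * (a i * (x / (x + y)) + b i * (1 - x / (x + y))) = a i * x + b i * y :=
    fun x y i hx hy => by linear_combination (a i - b i) * hu x y hx hy
  have main := sum_mul_convex_nonneg (ι := Fin n ⊕ Fin n')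
    (c := Sum.elim (fun j => p j + q j) fun i => -(p' i + q' i))
    (u := Sum.elim (fun j => p j / (p j + q j)) fun i => p' i / (p' i + q' i)) hg
    (by simp [Finset.sum_add_distrib, hp.2, hq.2, hp'.2, hq'.2])
    (by simp only [Fintype.sum_sum_type, Sum.elim_inl, Sum.elim_inr, neg_mul, hu _ _ (hp.1 _) (hq.1 _),
          hu _ _ (hp'.1 _) (hq'.1 _), Finset.sum_neg_distrib, hp.2, hp'.2]
        ring)
    (fun m => by
      simp only [Fintype.sum_sum_type, Sum.elim_inl, Sum.elim_inr, neg_mul,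
        habs _ _ _ (hp.1 _) (hq.1 _), habs _ _ _ (hp'.1 _) (hq'.1 _), Finset.sum_neg_distrib]
      have := h (1 - m) (-m)
      simp only [neg_mul] at this
      linarith)
  simp only [Fintype.sum_sum_type, Sum.elim_inl, Sum.elim_inr, neg_mul,
    Finset.sum_neg_distrib] at main
  calc ∑ i, (a i * p' i + b i * q' i)
      ≤ ∑ i, (p' i + q' i) * g (p' i / (p' i + q' i)) := Finset.sum_le_sum fun i _ => by
        rw [← hlin _ _ _ (hp'.1 i) (hq'.1 i)]
        exact mul_le_mul_of_nonneg_left (hle _ i) (add_nonneg (hp'.1 i) (hq'.1 i))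
    _ ≤ ∑ j, (p j + q j) * g (p j / (p j + q j)) := by linarith
    _ ≤ ∑ j, (a (k j) * p j + b (k j) * q j) := Finset.sum_le_sum fun j _ => by
        obtain ⟨i, -, hi⟩ := Finset.exists_mem_eq_sup' hne fun i =>
          a i * (p j / (p j + q j)) + b i * (1 - p j / (p j + q j))
        simp only [g, hi, hlin _ _ _ (hp.1 j) (hq.1 j)]
        exact hk j i

/-! ### Stochastic matrices and separation -/

/-- A separating functional is maximized over stochastic matrices column by column, so that
`sum_linear_le_sum_of_abs_le` excludes it. -/
theorem relMajorizes_of_abs_le {n n' : ℕ} {p q : Fin n → ℝ} {p' q' : Fin n' → ℝ}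
    (hp : p ∈ ProbVec n) (hq : q ∈ ProbVec n) (hp' : p' ∈ ProbVec n') (hq' : q' ∈ ProbVec n')
    (h : ∀ α β : ℝ, ∑ i, |α * p' i + β * q' i| ≤ ∑ j, |α * p j + β * q j|) :
    RelMajorizes p q p' q' := by
  -- A stochastic matrix is encoded by its columns, a point of a product of simplices.
  let K : Set (Fin n → Fin n' → ℝ) := Set.univ.pi fun _ => stdSimplex ℝ (Fin n')
  let L : (Fin n → Fin n' → ℝ) →ₗ[ℝ] (Fin n' → ℝ) × (Fin n' → ℝ) :=
    (∑ j, p j • LinearMap.proj j).prod (∑ j, q j • LinearMap.proj j)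
  have hL : ∀ F, L F = (∑ j, p j • F j, ∑ j, q j • F j) := fun F => by
    simp [L]
  have hconv : Convex ℝ (L '' K) :=
    (convex_pi fun _ _ => convex_stdSimplex ℝ (Fin n')).linear_image L
  have hclosed : IsClosed (L '' K) :=
    ((isCompact_univ_pi fun _ => isCompact_stdSimplex ℝ (Fin n')).image
      L.continuous_of_finiteDimensional).isClosed
  by_cases hmem : (p', q') ∈ L '' K
  · obtain ⟨F, hF, hFe⟩ := hmem
    rw [hL, Prod.mk.injEq] at hFe
    have hmul : ∀ v : Fin n → ℝ, (Matrix.of fun i j => F j i) *ᵥ v = ∑ j, v j • F j := fun v => by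
      ext i
      simp [Matrix.mulVec, dotProduct, mul_comm]
    exact ⟨Matrix.of fun i j => F j i, ⟨fun i j => (hF j trivial).1 i, fun j => (hF j trivial).2⟩,
      (hmul p).trans hFe.1, (hmul q).trans hFe.2⟩
  · exfalso
    obtain ⟨f, r, hfK, hfr⟩ := geometric_hahn_banach_closed_point hconv hclosed hmem
    let a : Fin n' → ℝ := fun i => f (Pi.single i 1, 0)
    let b : Fin n' → ℝ := fun i => f (0, Pi.single i 1)
    have hf : ∀ x y : Fin n' → ℝ, f (x, y) = ∑ i, (a i * x i + b i * y i) := fun x y => by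
      have hx := LinearMap.pi_apply_eq_sum_univ (f.toLinearMap ∘ₗ LinearMap.inl ℝ _ _) x
      have hy := LinearMap.pi_apply_eq_sum_univ (f.toLinearMap ∘ₗ LinearMap.inr ℝ _ _) y
      have e : ∀ i : Fin n', (fun j => if i = j then (1 : ℝ) else 0) = Pi.single i 1 := fun i => by
        ext j; simp [Pi.single_apply, eq_comm]
      simp only [e, LinearMap.comp_apply, LinearMap.inl_apply, LinearMap.inr_apply,
        ContinuousLinearMap.coe_coe, smul_eq_mul] at hx hy
      have : (x, y) = (x, 0) + ((0 : Fin n' → ℝ), y) := by simp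
      rw [this, map_add, hx, hy, ← Finset.sum_add_distrib]
      exact Finset.sum_congr rfl fun i _ => by simp only [a, b]; ring
    have : Nonempty (Fin n') := by
      by_contra hne
      rw [not_nonempty_iff] at hne
      simpa using hp'.2
    choose k hk using fun j => Finite.exists_max fun i => a i * p j + b i * q j
    -- The functional is maximal on `L '' K` where each column is the unit vector of a best row.
    have hlt := hfK (L fun j => Pi.single (k j) 1)
      ⟨_, fun j _ => single_mem_stdSimplex ℝ (k j), rfl⟩
    have hval : f (L fun j => Pi.single (k j) 1) = ∑ j, (a (k j) * p j + b (k j) * q j) := by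
      have e : L (fun j => Pi.single (k j) 1) =
          ∑ j, (p j • (Pi.single (k j) (1 : ℝ), (0 : Fin n' → ℝ)) +
            q j • ((0 : Fin n' → ℝ), Pi.single (k j) (1 : ℝ))) := by
        rw [hL]
        ext <;> simp [Prod.fst_sum, Prod.snd_sum]
      rw [e, map_sum]
      exact Finset.sum_congr rfl fun j _ => by
        simp only [map_add, map_smul, smul_eq_mul, a, b]; ring
    have := sum_linear_le_sum_of_abs_le hp hq hp' hq' h a b k hk
    rw [hval] at hlt
    rw [hf] at hfr
    linarith

/-! ### Testing regions -/

theorem testingRegion_subset_of_relMajorizes {n n' : ℕ} {p q : Fin n → ℝ} {p' q' : Fin n' → ℝ}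
    (h : RelMajorizes p q p' q') : testingRegion p' q' ⊆ testingRegion p q := by
  obtain ⟨E, ⟨hE0, hE1⟩, rfl, rfl⟩ := h
  rintro _ ⟨t, ht, rfl⟩
  refine ⟨t ᵥ* E, fun j => ⟨?_, ?_⟩, by simp only [Matrix.dotProduct_mulVec]⟩
  · rw [Matrix.vecMul, dotProduct]
    exact Finset.sum_nonneg fun i _ => mul_nonneg (ht i).1 (hE0 i j)
  · rw [← hE1 j, Matrix.vecMul, dotProduct]
    exact Finset.sum_le_sum fun i _ => mul_le_of_le_one_left (hE0 i j) (ht i).2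

/-- A test `t` bounds the `1`-norm from below. -/
theorem two_mul_dotProduct_sub_sum_le {n : ℕ} {t : Fin n → ℝ}
    (ht : ∀ i, t i ∈ Set.Icc (0 : ℝ) 1) (v : Fin n → ℝ) :
    2 * (t ⬝ᵥ v) - ∑ i, v i ≤ oneNorm v := by
  rw [oneNorm_eq_sum_abs, dotProduct, Finset.mul_sum, ← Finset.sum_sub_distrib]
  refine Finset.sum_le_sum fun i _ => ?_
  have h1 : |2 * t i - 1| ≤ 1 := abs_le.2 ⟨by linarith [(ht i).1], by linarith [(ht i).2]⟩
  calc 2 * (t i * v i) - v i = (2 * t i - 1) * v i := by ring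
    _ ≤ |2 * t i - 1| * |v i| := (le_abs_self _).trans_eq (abs_mul _ _)
    _ ≤ |v i| := mul_le_of_le_one_left (abs_nonneg _) h1

/-- The indicator test of the positive part of `v` attains the `1`-norm. -/
theorem exists_two_mul_dotProduct_sub_sum_eq {n : ℕ} (v : Fin n → ℝ) :
    ∃ t : Fin n → ℝ, (∀ i, t i ∈ Set.Icc (0 : ℝ) 1) ∧ 2 * (t ⬝ᵥ v) - ∑ i, v i = oneNorm v := by
  refine ⟨fun i => if 0 ≤ v i then 1 else 0, fun i => ?_, ?_⟩
  · dsimp only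
    split_ifs <;> simp
  · rw [oneNorm_eq_sum_abs, dotProduct, Finset.mul_sum, ← Finset.sum_sub_distrib]
    refine Finset.sum_congr rfl fun i _ => ?_
    split_ifs with hi
    · rw [abs_of_nonneg hi]; ring
    · rw [abs_of_neg (not_le.1 hi)]; ring

theorem oneNorm_le_of_testingRegion_subset {n n' : ℕ} {p q : Fin n → ℝ} {p' q' : Fin n' → ℝ}
    (hp : p ∈ ProbVec n) (hq : q ∈ ProbVec n) (hp' : p' ∈ ProbVec n') (hq' : q' ∈ ProbVec n')
    (h : testingRegion p' q' ⊆ testingRegion p q) (r : ℝ) :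
    oneNorm (p' - r • q') ≤ oneNorm (p - r • q) := by
  obtain ⟨t', ht', e'⟩ := exists_two_mul_dotProduct_sub_sum_eq (p' - r • q')
  obtain ⟨t, ht, e⟩ := h ⟨t', ht', rfl⟩
  rw [Prod.mk.injEq] at e
  have hle := two_mul_dotProduct_sub_sum_le ht (p - r • q)
  simp only [dotProduct_sub, dotProduct_smul, Pi.sub_apply, Pi.smul_apply, smul_eq_mul,
    Finset.sum_sub_distrib, ← Finset.mul_sum, hp.2, hq.2, hp'.2, hq'.2, e.1, e.2] at e' hle
  exact e'.symm.le.trans hle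

theorem mainTheorem1 {n n' : ℕ} (p q : Fin n → ℝ) (p' q' : Fin n' → ℝ)
    (hp : p ∈ ProbVec n) (hq : q ∈ ProbVec n) (hp' : p' ∈ ProbVec n') (hq' : q' ∈ ProbVec n') :
    List.TFAE [
      RelMajorizes p q p' q',
      ∀ t : ℝ, oneNorm (p - t • q) ≥ oneNorm (p' - t • q'),
      testingRegion p q ⊇ testingRegion p' q'] := by
  tfae_have 1 → 3 := testingRegion_subset_of_relMajorizes
  tfae_have 3 → 2 := oneNorm_le_of_testingRegion_subset hp hq hp' hq'
  tfae_have 2 → 1 := fun h =>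
    relMajorizes_of_abs_le hp hq hp' hq' (sum_abs_le_of_oneNorm_le hq hq' h)
  tfae_finish
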